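/- Let $a, b, m, M \in \mathbb{R}$ with $0 \le b < 1$, and consider the boundary value problem $$f''' + \frac{m+1}{2} f f'' + m\,(1 - f'^2) + M\,(1 - f') = 0 \quad \text{on } [0,\infty), \qquad f(0) = a, \quad f'(0) = b, \quad \lim_{t\to\infty} f'(t) = 1.$$ Suppose that one of the following holds: - $-1 < m < 0$ and $M \ge -2m$; - $m \ge 0$ and $M > -m(b+1)$. Then this problem has exactly one solution $f \in C^3([0,\infty))$ that is convex on $[0,\infty)$. Moreover, there exists $l < a$ such that $\lim_{t\to\infty} \{f(t) - (t+l)\} = 0$, and $t + l \le f(t) \le t + a$ for all $t \ge 0$. -/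

import Mathlib

/-- `f` solves `f''' + (m+1)/2 f f'' + m (1 - f'^2) + M (1 - f') = 0` on `[0, ∞)` in the classical
sense, with `f(0) = a`, `f'(0) = b` and `f'(t) → 1` as `t → ∞`. Derivatives are taken within
`[0, ∞)`, hence are one-sided at `0`; values of `f` at negative arguments play no role. -/
structure IsMHDSolution (m M a b : ℝ) (f : ℝ → ℝ) : Prop where
  contDiffOn : ContDiffOn ℝ 3 f (Set.Ici 0)
  equation : ∀ t : ℝ, 0 ≤ t →
    iteratedDerivWithin 3 f (Set.Ici 0) t
      + (m + 1) / 2 * f t * iteratedDerivWithin 2 f (Set.Ici 0) t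
      + m * (1 - derivWithin f (Set.Ici 0) t ^ 2)
      + M * (1 - derivWithin f (Set.Ici 0) t) = 0
  apply_zero : f 0 = a
  deriv_zero : derivWithin f (Set.Ici 0) 0 = b
  deriv_infty : Filter.Tendsto (derivWithin f (Set.Ici 0)) Filter.atTop (nhds 1)

/-- A solution of the boundary value problem which is convex on `[0, ∞)`. -/
def IsConvexMHDSolution (m M a b : ℝ) (f : ℝ → ℝ) : Prop :=
  IsMHDSolution m M a b f ∧ ConvexOn ℝ (Set.Ici 0) f

open Set Filter Topology NNReal

/-! ### Calculus on the half-line -/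

/-! Put k = (m+1)/2 and F = `slopeForce m M`, so that f''' = -k f f'' - F(f'). The conditions on m
and M enter only through k > 0 and F > 0 on [b, 1) (`slopeForce_pos`); moreover F(1) = 0.

Existence is by shooting on c = f''(0) in [0, C]. The system is clipped to be globally solvable and
continuous in c. The values of c for which the slope exceeds 1 and those for which the curvature
becomes negative form two open sets. They are disjoint on [0, C] (`snd_le_one_of_trd_neg`); the
first contains C (`one_lt_snd`), the second 0 (`exists_trd_neg`). As [0, C] is connected, some c
lies in neither, and for it the clipping is inactive.

For a convex profile, f' staying below some μ < 1 would keep F bounded away from 0 and force f'' <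
0, so f' tends to 1. Once k f ≥ 1, f'' + f' decreases and stays ≥ 1, so 1 - f' ≤ f'' is integrable
and f(t) - t converges.

Uniqueness takes the slope u as variable: the curvature p(u) and height q(u) satisfy p' = -k q -
F/p, q' = u/p. If one curve p starts above another, the gap never shrinks
(`IsCroccoCurve.sub_le_sub`), although the larger p takes arbitrarily small positive values. Hence
f''(0) is determined, and so is f. -/

/-- A function with nonnegative derivative between `s` and `e` satisfies `φ s ≤ φ e`. -/
lemma le_of_hasDerivWithinAt_nonneg {φ φ' : ℝ → ℝ}
    (h : ∀ t, 0 ≤ t → HasDerivWithinAt φ (φ' t) (Ici 0) t) {s e : ℝ} (hs : 0 ≤ s) (hse : s ≤ e)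
    (hn : ∀ t ∈ Ioo s e, 0 ≤ φ' t) : φ s ≤ φ e := by
  have hmono : MonotoneOn φ (Icc s e) := by
    refine monotoneOn_of_hasDerivWithinAt_nonneg (convex_Icc s e) (f' := φ') ?_ ?_ ?_
    · intro t ht
      exact ((h t (hs.trans ht.1)).continuousWithinAt).mono fun r hr => hs.trans hr.1
    · intro t ht
      rw [interior_Icc] at ht ⊢
      exact (h t (hs.trans ht.1.le)).mono fun r hr => hs.trans hr.1.le
    · intro t ht
      rw [interior_Icc] at ht
      exact hn t ht
  exact hmono (left_mem_Icc.2 hse) (right_mem_Icc.2 hse) hse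

/-- A continuous function which is positive at `s` and nonpositive at `e` has a first zero. -/
lemma exists_first_zero {h : ℝ → ℝ} {s e : ℝ} (hse : s ≤ e) (hc : ContinuousOn h (Icc s e))
    (hs : 0 < h s) (he : h e ≤ 0) :
    ∃ r ∈ Ioc s e, h r = 0 ∧ ∀ t ∈ Ico s r, 0 < h t := by
  have hcl : IsClosed {t ∈ Icc s e | h t ≤ 0} :=
    hc.preimage_isClosed_of_isClosed isClosed_Icc isClosed_Iic
  have hcp : IsCompact {t ∈ Icc s e | h t ≤ 0} :=
    isCompact_Icc.of_isClosed_subset hcl fun t ht => ht.1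
  obtain ⟨r, ⟨hr, hr0⟩, hmin⟩ :=
    hcp.exists_isLeast ⟨e, ⟨⟨hse, le_rfl⟩, he⟩⟩
  have hpos : ∀ t ∈ Ico s r, 0 < h t := fun t ht => by
    by_contra hneg
    exact absurd (hmin ⟨⟨ht.1, ht.2.le.trans hr.2⟩, not_lt.1 hneg⟩) (not_le.2 ht.2)
  have hsr : s < r := lt_of_le_of_ne hr.1 fun heq => by
    rw [← heq] at hr0; linarith
  obtain ⟨q, hq, hq0⟩ := intermediate_value_Icc' hr.1 (hc.mono (Icc_subset_Icc le_rfl hr.2))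
    (show (0 : ℝ) ∈ Icc (h r) (h s) from ⟨hr0, hs.le⟩)
  have hqr : q = r := le_antisymm hq.2 (hmin ⟨⟨hq.1, hq.2.trans hr.2⟩, hq0.le⟩)
  exact ⟨r, ⟨hsr, hr.2⟩, hqr ▸ hq0, hpos⟩

/-- A function which vanishes at `s` and has negative derivative there is negative just after. -/
lemma exists_neg_of_hasDerivWithinAt_neg {φ : ℝ → ℝ} {d s : ℝ} (hs : 0 ≤ s)
    (h : HasDerivWithinAt φ d (Ici 0) s) (hd : d < 0) (h0 : φ s = 0) : ∃ t, s < t ∧ φ t < 0 := by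
  have h' : HasDerivWithinAt φ d (Ioi s) s := h.mono fun r hr => hs.trans (le_of_lt hr)
  have := (hasDerivWithinAt_iff_tendsto_slope' (lt_irrefl s)).1 h'
  have hev : ∀ᶠ t in 𝓝[>] s, slope φ s t < 0 ∧ s < t :=
    (this.eventually (gt_mem_nhds hd)).and self_mem_nhdsWithin
  obtain ⟨t, ht, hst⟩ := hev.exists
  refine ⟨t, hst, ?_⟩
  rw [slope_def_field, h0, sub_zero] at ht
  have hst' : 0 < t - s := sub_pos.2 hst
  by_contra hneg
  exact absurd ht (not_lt.2 (div_nonneg (not_lt.1 hneg) hst'.le))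

/-! ### Global solutions of bounded Lipschitz differential equations -/

section ODE

variable {E : Type*} [NormedAddCommGroup E] [NormedSpace ℝ E]

lemma dist_le_of_trajectories_Ici {v : ℝ → E → E} {K : ℝ≥0} {T : ℝ}
    (hv : ∀ t ∈ Icc 0 T, LipschitzWith K (v t)) {α β : ℝ → E}
    (hα : ∀ t ∈ Icc 0 T, HasDerivWithinAt α (v t (α t)) (Icc 0 T) t)
    (hβ : ∀ t ∈ Icc 0 T, HasDerivWithinAt β (v t (β t)) (Icc 0 T) t) {t : ℝ}
    (ht : t ∈ Icc 0 T) :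
    dist (α t) (β t) ≤ dist (α 0) (β 0) * Real.exp (K * t) := by
  have key : ∀ γ : ℝ → E, (∀ t ∈ Icc 0 T, HasDerivWithinAt γ (v t (γ t)) (Icc 0 T) t) →
      ∀ t ∈ Ico 0 T, HasDerivWithinAt γ (v t (γ t)) (Ici t) t := fun γ hγ t ht =>
    (hγ t ⟨ht.1, ht.2.le⟩).mono_of_mem_nhdsWithin
      (mem_of_superset (Icc_mem_nhdsGE ht.2) (Icc_subset_Icc ht.1 le_rfl))
  have := dist_le_of_trajectories_ODE_of_mem (v := v) (s := fun _ => univ) (K := K)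
    (fun t ht => (hv t ⟨ht.1, ht.2.le⟩).lipschitzOnWith)
    (fun t ht => (hα t ht).continuousWithinAt) (key α hα) (fun _ _ => trivial)
    (fun t ht => (hβ t ht).continuousWithinAt) (key β hβ) (fun _ _ => trivial) le_rfl t ht
  simpa using this

/-- The field is bounded on the whole space, so Picard–Lindelöf covers each [0, T] in one step;
Grönwall glues the pieces. -/
lemma exists_solution_Ici [CompleteSpace E] {v : ℝ → E → E}
    (hlip : ∀ T, 0 ≤ T → ∃ K : ℝ≥0, ∀ t ∈ Icc 0 T, LipschitzWith K (v t))
    (hcont : ∀ x, ContinuousOn (fun t => v t x) (Ici 0))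
    (hbdd : ∀ T, 0 ≤ T → ∃ L : ℝ≥0, ∀ t ∈ Icc 0 T, ∀ x, ‖v t x‖ ≤ L) (x₀ : E) :
    ∃ α : ℝ → E, α 0 = x₀ ∧ ∀ t, 0 ≤ t → HasDerivWithinAt α (v t (α t)) (Ici 0) t := by
  have hloc : ∀ T : ℝ, ∃ α : ℝ → E, 0 ≤ T → (α 0 = x₀ ∧
      ∀ t ∈ Icc 0 T, HasDerivWithinAt α (v t (α t)) (Icc 0 T) t) := by
    intro T
    by_cases hT : 0 ≤ T
    · obtain ⟨K, hK⟩ := hlip T hT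
      obtain ⟨L, hL⟩ := hbdd T hT
      -- A solution of speed at most L moves at most L * T in time T, so a ball of that radius
      -- suffices.
      have hPL : IsPicardLindelof v (⟨0, le_rfl, hT⟩ : Icc (0 : ℝ) T) x₀ (L * T.toNNReal) 0 L K :=
        { lipschitzOnWith := fun t ht => (hK t ht).lipschitzOnWith
          continuousOn := fun x _ => (hcont x).mono fun t ht => ht.1
          norm_le := fun t ht x _ => hL t ht x
          mul_max_le := by simp [hT] }
      obtain ⟨α, hα⟩ := hPL.exists_eq_forall_mem_Icc_hasDerivWithinAt₀
      exact ⟨α, fun _ => hα⟩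
    · exact ⟨fun _ => x₀, fun h => absurd h hT⟩
  choose X hX using hloc
  have hagree : ∀ S T t : ℝ, 0 ≤ t → t ≤ S → S ≤ T → X S t = X T t := by
    intro S T t h0 hS hST
    have hS0 := h0.trans hS
    have hT0 := hS0.trans hST
    obtain ⟨K, hK⟩ := hlip S hS0
    have := dist_le_of_trajectories_Ici hK (hX S hS0).2
      (fun t ht => ((hX T hT0).2 t ⟨ht.1, ht.2.trans hST⟩).mono (Icc_subset_Icc le_rfl hST))
      ⟨h0, hS⟩
    rw [(hX S hS0).1, (hX T hT0).1, dist_self, zero_mul] at this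
    exact dist_le_zero.1 this
  have hval : ∀ T t : ℝ, 0 ≤ t → t ≤ T → X t t = X T t := fun T t h0 hT =>
    hagree t T t h0 le_rfl hT
  refine ⟨fun t => X t t, (hX 0 le_rfl).1, fun t ht => ?_⟩
  have hd := (hX (t + 1) (by linarith)).2 t ⟨ht, by linarith⟩
  have hd' : HasDerivWithinAt (X (t + 1)) (v t (X (t + 1) t)) (Ici 0) t := by
    refine hd.mono_of_mem_nhdsWithin ?_
    rw [show Icc (0 : ℝ) (t + 1) = Ici 0 ∩ Iic (t + 1) from rfl]
    exact inter_mem self_mem_nhdsWithin (mem_nhdsWithin_of_mem_nhds (Iic_mem_nhds (by linarith)))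
  rw [← hval (t + 1) t ht (by linarith)] at hd'
  refine hd'.congr_of_eventuallyEq ?_ (hval (t + 1) t ht (by linarith))
  filter_upwards [self_mem_nhdsWithin, mem_nhdsWithin_of_mem_nhds
    (Iic_mem_nhds (show t < t + 1 by linarith))] with r hr hr'
  exact hval (t + 1) r hr hr'

end ODE

/-! ### The first order system -/

/-- The part of the equation depending on the slope `u = f'` only. -/
def slopeForce (m M u : ℝ) : ℝ := m * (1 - u ^ 2) + M * (1 - u)

/-- The nearest point to `u` in `[p, q]`. -/
def clip (p q u : ℝ) : ℝ := max p (min q u)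

lemma clip_mem {p q : ℝ} (h : p ≤ q) (u : ℝ) : clip p q u ∈ Icc p q :=
  ⟨le_max_left _ _, max_le h (min_le_left _ _)⟩

lemma clip_of_mem {p q u : ℝ} (h : u ∈ Icc p q) : clip p q u = u := by
  rw [clip, min_eq_right h.2, max_eq_right h.1]

lemma clip_of_le {p q u : ℝ} (hpq : p ≤ q) (h : u ≤ p) : clip p q u = p := by
  rw [clip, min_eq_right (h.trans hpq), max_eq_left h]

lemma clip_of_ge {p q u : ℝ} (hpq : p ≤ q) (h : q ≤ u) : clip p q u = q := by
  rw [clip, min_eq_left h, max_eq_right hpq]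

lemma clip_mono {p q u w : ℝ} (h : u ≤ w) : clip p q u ≤ clip p q w :=
  max_le_max le_rfl (min_le_min le_rfl h)

lemma abs_clip_sub_le (p q u w : ℝ) : |clip p q u - clip p q w| ≤ |u - w| := by
  have h := ((LipschitzWith.id (α := ℝ)).const_min q).const_max p
  have := h.dist_le_mul u w
  simpa [Real.dist_eq, clip] using this

lemma abs_slopeForce_sub_le {m M u w : ℝ} (hu : u ∈ Icc (0 : ℝ) 1) (hw : w ∈ Icc (0 : ℝ) 1) :
    |slopeForce m M u - slopeForce m M w| ≤ (2 * |m| + |M|) * |u - w| := by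
  have : slopeForce m M u - slopeForce m M w = -(m * (u + w) + M) * (u - w) := by
    simp only [slopeForce]; ring
  rw [this, abs_mul, abs_neg]
  gcongr
  refine (abs_add_le _ _).trans ?_
  rw [abs_mul, abs_of_nonneg (add_nonneg hu.1 hw.1)]
  nlinarith [abs_nonneg m, hu.2, hw.2]

lemma abs_slopeForce_le {m M u : ℝ} (hu : u ∈ Icc (0 : ℝ) 1) :
    |slopeForce m M u| ≤ (2 * |m| + |M|) * (1 - u) := by
  have := abs_slopeForce_sub_le (m := m) (M := M) hu (right_mem_Icc.2 zero_le_one)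
  have h1 : slopeForce m M 1 = 0 := by simp [slopeForce]
  rwa [h1, sub_zero, abs_sub_comm, abs_of_nonneg (sub_nonneg.2 hu.2)] at this

/-- The first order system of `f''' + k f f'' + slopeForce f' = 0` with every variable clipped to
a region containing all convex solutions with `f(0) = a`, `f'(0) = b`, `f'' ≤ Z`. -/
def clippedField (k m M a b Z t : ℝ) (X : ℝ × ℝ × ℝ) : ℝ × ℝ × ℝ :=
  (clip b 1 X.2.1, clip 0 Z X.2.2,
    -(k * clip (-(|a| + t)) (|a| + t) X.1 * clip 0 Z X.2.2) - slopeForce m M (clip b 1 X.2.1))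

lemma lipschitzWith_clippedField (k m M a : ℝ) {b Z : ℝ} (hb0 : 0 ≤ b) (hb1 : b < 1)
    (hZ : 0 ≤ Z) (T : ℝ) :
    ∃ K : ℝ≥0, ∀ t ∈ Icc 0 T, LipschitzWith K (clippedField k m M a b Z t) := by
  by_cases hT : 0 ≤ T
  swap
  · exact ⟨0, fun t ht => absurd (ht.1.trans ht.2) hT⟩
  have hK : 0 ≤ 1 + |k| * (|a| + T + Z) + (2 * |m| + |M|) := by positivity
  obtain ⟨K, hKeq⟩ : ∃ K : ℝ≥0, (K : ℝ) = 1 + |k| * (|a| + T + Z) + (2 * |m| + |M|) :=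
    ⟨⟨_, hK⟩, rfl⟩
  refine ⟨K, fun t ht => LipschitzWith.of_dist_le_mul fun X Y => ?_⟩
  have hR : 0 ≤ |a| + t := add_nonneg (abs_nonneg a) ht.1
  set d := dist X Y with hd
  have hx : |X.1 - Y.1| ≤ d := by rw [hd, Prod.dist_eq]; exact le_max_left _ _
  have hyz : dist X.2 Y.2 ≤ d := by rw [hd, Prod.dist_eq]; exact le_max_right _ _
  have hy : |X.2.1 - Y.2.1| ≤ d := le_trans (by rw [Prod.dist_eq]; exact le_max_left _ _) hyz
  have hz : |X.2.2 - Y.2.2| ≤ d := le_trans (by rw [Prod.dist_eq]; exact le_max_right _ _) hyz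
  have hd0 : 0 ≤ d := dist_nonneg
  have hcx := (abs_clip_sub_le (-(|a| + t)) (|a| + t) X.1 Y.1).trans hx
  have hcy := (abs_clip_sub_le b 1 X.2.1 Y.2.1).trans hy
  have hcz := (abs_clip_sub_le 0 Z X.2.2 Y.2.2).trans hz
  have hsub : ∀ u, clip b 1 u ∈ Icc (0 : ℝ) 1 := fun u =>
    ⟨hb0.trans (clip_mem hb1.le u).1, (clip_mem hb1.le u).2⟩
  have hF := (abs_slopeForce_sub_le (m := m) (M := M) (hsub X.2.1) (hsub Y.2.1)).trans
    (mul_le_mul_of_nonneg_left hcy (by positivity))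
  have hxb : |clip (-(|a| + t)) (|a| + t) X.1| ≤ |a| + T := by
    have := clip_mem (neg_le_self hR) X.1
    exact (abs_le.2 this).trans (by linarith [ht.2])
  have hzb : |clip 0 Z Y.2.2| ≤ Z := by
    have := clip_mem hZ Y.2.2
    rw [abs_of_nonneg this.1]; exact this.2
  have h1 : 1 * d ≤ (1 + |k| * (|a| + T + Z) + (2 * |m| + |M|)) * d := by
    gcongr
    have : 0 ≤ |k| * (|a| + T + Z) + (2 * |m| + |M|) := by positivity
    linarith
  rw [one_mul] at h1
  rw [hKeq, Prod.dist_eq, Prod.dist_eq]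
  refine max_le (hcy.trans h1) (max_le (hcz.trans h1) ?_)
  simp only [clippedField, Real.dist_eq]
  set x₁ := clip (-(|a| + t)) (|a| + t) X.1
  set x₂ := clip (-(|a| + t)) (|a| + t) Y.1
  set z₁ := clip 0 Z X.2.2
  set z₂ := clip 0 Z Y.2.2
  set g₁ := slopeForce m M (clip b 1 X.2.1)
  set g₂ := slopeForce m M (clip b 1 Y.2.1)
  -- The product is split so that each difference multiplies a clipped, hence bounded, factor.
  have e : -(k * x₁ * z₁) - g₁ - (-(k * x₂ * z₂) - g₂)
      = -(k * (x₁ * (z₁ - z₂) + (x₁ - x₂) * z₂)) - (g₁ - g₂) := by ring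
  rw [e]
  refine (abs_sub _ _).trans ?_
  rw [abs_neg, abs_mul]
  have hp : |x₁ * (z₁ - z₂) + (x₁ - x₂) * z₂| ≤ (|a| + T + Z) * d := by
    refine (abs_add_le _ _).trans ?_
    rw [abs_mul, abs_mul]
    have e1 := mul_le_mul hxb hcz (abs_nonneg _) (by positivity)
    have e2 := mul_le_mul hcx hzb (abs_nonneg _) hd0
    nlinarith
  have := mul_le_mul_of_nonneg_left hp (abs_nonneg k)
  nlinarith

lemma norm_clippedField_le (k m M a : ℝ) {b Z : ℝ} (hb0 : 0 ≤ b) (hb1 : b < 1)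
    (hZ : 0 ≤ Z) (T : ℝ) (hT : 0 ≤ T) :
    ∃ L : ℝ≥0, ∀ t ∈ Icc 0 T, ∀ X, ‖clippedField k m M a b Z t X‖ ≤ L := by
  have hL : 0 ≤ 1 + Z + |k| * (|a| + T) * Z + (2 * |m| + |M|) := by positivity
  obtain ⟨L, hLeq⟩ : ∃ L : ℝ≥0, (L : ℝ) = 1 + Z + |k| * (|a| + T) * Z + (2 * |m| + |M|) :=
    ⟨⟨_, hL⟩, rfl⟩
  refine ⟨L, fun t ht X => ?_⟩
  have hR : 0 ≤ |a| + t := add_nonneg (abs_nonneg a) ht.1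
  have hy := clip_mem hb1.le X.2.1
  have hz := clip_mem hZ X.2.2
  have hx : |clip (-(|a| + t)) (|a| + t) X.1| ≤ |a| + T :=
    (abs_le.2 (clip_mem (neg_le_self hR) X.1)).trans (by linarith [ht.2])
  have hF := abs_slopeForce_le (m := m) (M := M)
    (show clip b 1 X.2.1 ∈ Icc (0 : ℝ) 1 from ⟨hb0.trans hy.1, hy.2⟩)
  have p1 : 0 ≤ |k| * (|a| + T) * Z := by positivity
  have p2 : 0 ≤ 2 * |m| + |M| := by positivity
  have hF' : |slopeForce m M (clip b 1 X.2.1)| ≤ 2 * |m| + |M| :=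
    hF.trans (by nlinarith [hb0.trans hy.1])
  rw [hLeq, Prod.norm_def, Prod.norm_def]
  simp only [clippedField, Real.norm_eq_abs]
  refine max_le ?_ (max_le ?_ ?_)
  · rw [abs_of_nonneg (hb0.trans hy.1)]; linarith [hy.2]
  · rw [abs_of_nonneg hz.1]; linarith [hz.2]
  · refine (abs_sub _ _).trans ?_
    rw [abs_neg, abs_mul, abs_mul]
    have : |k| * |clip (-(|a| + t)) (|a| + t) X.1| * |clip 0 Z X.2.2|
        ≤ |k| * (|a| + T) * Z := by
      gcongr
      rw [abs_of_nonneg hz.1]; exact hz.2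
    linarith

lemma continuous_clippedField (k m M a b Z : ℝ) (X : ℝ × ℝ × ℝ) :
    Continuous fun t => clippedField k m M a b Z t X := by
  unfold clippedField clip
  fun_prop

/-- The integral curve of `clippedField` with initial value `(a, b, c)`, in coordinates. -/
structure IsClippedSolution (k m M a b Z c : ℝ) (x y z : ℝ → ℝ) : Prop where
  hasDeriv_fst : ∀ t, 0 ≤ t → HasDerivWithinAt x (clip b 1 (y t)) (Ici 0) t
  hasDeriv_snd : ∀ t, 0 ≤ t → HasDerivWithinAt y (clip 0 Z (z t)) (Ici 0) t
  hasDeriv_trd : ∀ t, 0 ≤ t → HasDerivWithinAt z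
    (-(k * clip (-(|a| + t)) (|a| + t) (x t) * clip 0 Z (z t))
      - slopeForce m M (clip b 1 (y t))) (Ici 0) t
  fst_zero : x 0 = a
  snd_zero : y 0 = b
  trd_zero : z 0 = c

/-- `x` is a solution of `x''' + k x x'' + slopeForce x' = 0` on `[0, ∞)` with `x(0) = a`,
`x'(0) = b`, which is convex and has slope at most `1`; `y` and `z` are its derivatives. -/
structure IsConvexProfile (k m M a b : ℝ) (x y z : ℝ → ℝ) : Prop where
  hasDeriv_fst : ∀ t, 0 ≤ t → HasDerivWithinAt x (y t) (Ici 0) t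
  hasDeriv_snd : ∀ t, 0 ≤ t → HasDerivWithinAt y (z t) (Ici 0) t
  hasDeriv_trd : ∀ t, 0 ≤ t →
    HasDerivWithinAt z (-(k * x t * z t) - slopeForce m M (y t)) (Ici 0) t
  fst_zero : x 0 = a
  snd_zero : y 0 = b
  snd_le_one : ∀ t, 0 ≤ t → y t ≤ 1
  trd_nonneg : ∀ t, 0 ≤ t → 0 ≤ z t

lemma exists_isClippedSolution (k m M a c : ℝ) {b Z : ℝ} (hb0 : 0 ≤ b) (hb1 : b < 1)
    (hZ : 0 ≤ Z) : ∃ x y z : ℝ → ℝ, IsClippedSolution k m M a b Z c x y z := by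
  obtain ⟨α, h0, hα⟩ := exists_solution_Ici (v := clippedField k m M a b Z)
    (fun T _ => lipschitzWith_clippedField k m M a hb0 hb1 hZ T)
    (fun X => (continuous_clippedField k m M a b Z X).continuousOn)
    (fun T hT => norm_clippedField_le k m M a hb0 hb1 hZ T hT) (a, b, c)
  refine ⟨fun t => (α t).1, fun t => (α t).2.1, fun t => (α t).2.2, fun t ht => (hα t ht).fst,
    fun t ht => (hα t ht).snd.fst, fun t ht => (hα t ht).snd.snd, ?_, ?_, ?_⟩ <;> simp [h0]

/-! ### Shooting: how clipped solutions depend on the initial curvature -/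

namespace IsClippedSolution

variable {k m M a b Z c : ℝ} {x y z : ℝ → ℝ}

/-- Grönwall for initial values differing only in the curvature. One K serves all solutions on [0,
T], which makes the shooting sets open. -/
lemma abs_sub_le (hb0 : 0 ≤ b) (hb1 : b < 1) (hZ : 0 ≤ Z) (T : ℝ) :
    ∃ K : ℝ, 0 < K ∧ ∀ (c c' : ℝ) (x y z x' y' z' : ℝ → ℝ),
      IsClippedSolution k m M a b Z c x y z → IsClippedSolution k m M a b Z c' x' y' z' →
      ∀ t ∈ Icc 0 T, |x t - x' t| ≤ |c - c'| * K ∧ |y t - y' t| ≤ |c - c'| * K ∧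
        |z t - z' t| ≤ |c - c'| * K := by
  obtain ⟨K, hK⟩ := lipschitzWith_clippedField k m M a hb0 hb1 hZ T
  refine ⟨Real.exp (K * T), Real.exp_pos _, fun c c' x y z x' y' z' h h' t ht => ?_⟩
  have hsub : Icc 0 T ⊆ Ici 0 := fun s hs => hs.1
  have key := dist_le_of_trajectories_Ici hK (α := fun t => (x t, y t, z t))
    (β := fun t => (x' t, y' t, z' t))
    (fun t ht => ((h.hasDeriv_fst t ht.1).prodMk
      ((h.hasDeriv_snd t ht.1).prodMk (h.hasDeriv_trd t ht.1))).mono hsub)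
    (fun t ht => ((h'.hasDeriv_fst t ht.1).prodMk
      ((h'.hasDeriv_snd t ht.1).prodMk (h'.hasDeriv_trd t ht.1))).mono hsub) ht
  simp only [Prod.dist_eq, Real.dist_eq, h.fst_zero, h'.fst_zero, h.snd_zero, h'.snd_zero,
    h.trd_zero, h'.trd_zero, sub_self, abs_zero, abs_nonneg, sup_of_le_right] at key
  have hle : |c - c'| * Real.exp (K * t) ≤ |c - c'| * Real.exp (K * T) := by
    gcongr; exact ht.2
  exact ⟨(le_max_left _ _).trans (key.trans hle),
    (le_max_left _ _).trans ((le_max_right _ _).trans (key.trans hle)),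
    (le_max_right _ _).trans ((le_max_right _ _).trans (key.trans hle))⟩

lemma snd_mono (h : IsClippedSolution k m M a b Z c x y z) (hZ : 0 ≤ Z) {s t : ℝ} (hs : 0 ≤ s)
    (hst : s ≤ t) : y s ≤ y t :=
  le_of_hasDerivWithinAt_nonneg h.hasDeriv_snd hs hst fun _ _ => (clip_mem hZ _).1

lemma le_snd (h : IsClippedSolution k m M a b Z c x y z) (hZ : 0 ≤ Z) {t : ℝ} (ht : 0 ≤ t) :
    b ≤ y t := h.snd_zero ▸ h.snd_mono hZ le_rfl ht

lemma fst_mem (h : IsClippedSolution k m M a b Z c x y z) (hb0 : 0 ≤ b) (hb1 : b < 1) {t : ℝ}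
    (ht : 0 ≤ t) : x t ∈ Icc a (a + t) := by
  have h1 := le_of_hasDerivWithinAt_nonneg h.hasDeriv_fst le_rfl ht
    fun _ _ => hb0.trans (clip_mem hb1.le _).1
  have h2 := le_of_hasDerivWithinAt_nonneg
    (fun s hs => (hasDerivWithinAt_id s (Ici (0 : ℝ))).sub (h.hasDeriv_fst s hs)) le_rfl ht
    fun _ _ => sub_nonneg.2 (clip_mem hb1.le _).2
  simp only [Pi.sub_apply, id, h.fst_zero] at h1 h2
  exact ⟨h1, by linarith⟩

lemma clip_fst (h : IsClippedSolution k m M a b Z c x y z) (hb0 : 0 ≤ b) (hb1 : b < 1) {t : ℝ}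
    (ht : 0 ≤ t) : clip (-(|a| + t)) (|a| + t) (x t) = x t := by
  have := h.fst_mem hb0 hb1 ht
  exact clip_of_mem ⟨by linarith [this.1, neg_abs_le a], by linarith [this.2, le_abs_self a]⟩

lemma continuousOn_trd (h : IsClippedSolution k m M a b Z c x y z) : ContinuousOn z (Ici 0) :=
  fun t ht => (h.hasDeriv_trd t ht).continuousWithinAt

/-- While z < 0 the clipped curvature is 0, so z' = -F ≤ 0 and z cannot climb back to 0. -/
lemma trd_neg_of_le (h : IsClippedSolution k m M a b Z c x y z) (hb1 : b < 1) (hZ : 0 ≤ Z)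
    (hF : ∀ u ∈ Icc b 1, 0 ≤ slopeForce m M u) {s t : ℝ} (hs : 0 ≤ s) (hst : s ≤ t)
    (hz : z s < 0) : z t < 0 := by
  by_contra hneg
  obtain ⟨r, hr, hr0, hpos⟩ := exists_first_zero (h := fun u => -z u) hst
    (h.continuousOn_trd.neg.mono fun u hu => hs.trans hu.1) (by simpa using hz)
    (by simpa using hneg)
  have := le_of_hasDerivWithinAt_nonneg (fun t ht => (h.hasDeriv_trd t ht).neg) hs hr.1.le
    fun u hu => by
      have hu' : z u ≤ 0 := by linarith [hpos u ⟨hu.1.le, hu.2⟩]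
      rw [clip_of_le hZ hu']
      linarith [hF _ (clip_mem hb1.le (y u))]
  simp only [Pi.neg_apply] at this
  linarith

/-- A solution cannot both lose convexity and reach a slope greater than `1`. -/
lemma snd_le_one_of_trd_neg (h : IsClippedSolution k m M a b Z c x y z) (hb1 : b < 1)
    (hZ : 0 ≤ Z) (hc : 0 ≤ c) (hF : ∀ u ∈ Icc b 1, 0 ≤ slopeForce m M u) {s t : ℝ} (hs : 0 ≤ s)
    (ht : 0 ≤ t) (hz : z s < 0) : y t ≤ 1 := by
  by_contra! hy
  -- The slope stops growing once z < 0, so exceeding 1 at any time means having exceeded it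
  -- already.
  have hafter : ∀ r, 0 ≤ r → z r < 0 → 1 < y r := by
    intro r hr hzr
    rcases le_total t r with htr | hrt
    · exact hy.trans_le (h.snd_mono hZ ht htr)
    · have := le_of_hasDerivWithinAt_nonneg (fun u hu => (h.hasDeriv_snd u hu).neg) hr hrt
        fun u hu => by
          have hu' := h.trd_neg_of_le hb1 hZ hF hr hu.1.le hzr
          rw [clip_of_le hZ hu'.le, neg_zero]
      simp only [Pi.neg_apply] at this
      linarith
  -- Time is reversed to reach the last zero of z before s. From there to s the slope is clipped to
  -- 1, where F vanishes, so z' = 0 and z s cannot be negative.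
  obtain ⟨r, hr, hr0, hpos⟩ := exists_first_zero (h := fun u => -z (s - u)) hs
    (h.continuousOn_trd.neg.comp (by fun_prop) fun u hu => sub_nonneg.2 hu.2)
    (by simpa using hz) (by simpa [h.trd_zero] using hc)
  have := le_of_hasDerivWithinAt_nonneg h.hasDeriv_trd (sub_nonneg.2 hr.2)
    (by linarith [hr.1] : s - r ≤ s) fun u hu => by
      have hu0 : 0 ≤ u := by linarith [hu.1, hr.2]
      have hzu : z u < 0 := by
        have := hpos (s - u) ⟨by linarith [hu.2], by linarith [hu.1]⟩
        rw [sub_sub_cancel] at this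
        linarith
      rw [clip_of_le hZ hzu.le, clip_of_ge hb1.le (hafter u hu0 hzu).le]
      simp [slopeForce]
  linarith

lemma exists_trd_neg (h : IsClippedSolution k m M a b Z 0 x y z) (hb1 : b < 1) (hZ : 0 ≤ Z)
    (hF : 0 < slopeForce m M b) : ∃ t, 0 ≤ t ∧ z t < 0 := by
  obtain ⟨t, ht, hz⟩ := exists_neg_of_hasDerivWithinAt_neg le_rfl (h.hasDeriv_trd 0 le_rfl)
    (by
      rw [h.trd_zero, h.snd_zero, clip_of_mem (left_mem_Icc.2 hZ),
        clip_of_mem (left_mem_Icc.2 hb1.le)]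
      linarith) h.trd_zero
  exact ⟨t, ht.le, hz⟩

/-- If y 1 ≤ 1, the monotone quantity z + k(|a| + 1) y + (2|m| + |M|) t keeps z ≥ 2 on [0, 1],
whence y 1 ≥ b + 2. -/
lemma one_lt_snd (h : IsClippedSolution k m M a b Z c x y z) (hk : 0 ≤ k) (hb0 : 0 ≤ b)
    (hb1 : b < 1) (hZ : 2 ≤ Z) (hc : k * (|a| + 1) + (2 * |m| + |M|) + 2 ≤ c) : 1 < y 1 := by
  by_contra! hy
  have hZ0 : 0 ≤ Z := by linarith
  have hz : ∀ t ∈ Icc (0 : ℝ) 1, 2 ≤ z t := by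
    intro t ht
    have hG : 0 ≤ 2 * |m| + |M| := by positivity
    have := le_of_hasDerivWithinAt_nonneg
      (fun u hu => ((h.hasDeriv_trd u hu).add
        ((h.hasDeriv_snd u hu).const_mul (k * (|a| + 1)))).add
        ((hasDerivWithinAt_id u (Ici (0 : ℝ))).const_mul (2 * |m| + |M|))) le_rfl ht.1
      fun u hu => by
        have hu0 : 0 ≤ u := hu.1.le
        have hx := (h.fst_mem hb0 hb1 hu0).2
        rw [h.clip_fst hb0 hb1 hu0]
        have hcz := (clip_mem hZ0 (z u)).1
        have hcy := clip_mem hb1.le (y u)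
        have hF := (le_abs_self _).trans (abs_slopeForce_le (m := m) (M := M)
          (⟨hb0.trans hcy.1, hcy.2⟩ : clip b 1 (y u) ∈ Icc (0 : ℝ) 1))
        have h1 : (2 * |m| + |M|) * (1 - clip b 1 (y u)) ≤ 2 * |m| + |M| := by
          nlinarith [hb0.trans hcy.1]
        have h2 : 0 ≤ k * clip 0 Z (z u) * (|a| + 1 - x u) :=
          mul_nonneg (mul_nonneg hk hcz) (by linarith [le_abs_self a, hu.2, ht.2])
        nlinarith
    simp only [Pi.add_apply, id, h.trd_zero, h.snd_zero] at this
    have hyt : y t ≤ 1 := (h.snd_mono hZ0 ht.1 ht.2).trans hy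
    have h3 : 0 ≤ k * (|a| + 1) := by positivity
    have h4 := mul_le_mul_of_nonneg_left hyt h3
    have h5 := mul_nonneg h3 hb0
    have h6 := mul_le_mul_of_nonneg_left ht.2 hG
    linarith
  have := le_of_hasDerivWithinAt_nonneg
    (fun u hu => (h.hasDeriv_snd u hu).sub
      ((hasDerivWithinAt_id u (Ici (0 : ℝ))).const_mul 2)) le_rfl zero_le_one
    fun u hu => by
      have h1 := clip_mono (p := 0) (q := Z) (hz u ⟨hu.1.le, hu.2.le⟩)
      rw [clip_of_mem ⟨zero_le_two, hZ⟩] at h1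
      linarith
  simp only [Pi.sub_apply, id, h.snd_zero] at this
  linarith

/-- Since x ≥ -|a|, k|a| y - z is nondecreasing, which gives z ≤ c + k|a| ≤ Z: no clip is active. -/
lemma isConvexProfile (h : IsClippedSolution k m M a b Z c x y z) (hk : 0 ≤ k) (hb0 : 0 ≤ b)
    (hb1 : b < 1) (hZ : c + k * |a| ≤ Z) (hZ0 : 0 ≤ Z)
    (hF : ∀ u ∈ Icc b 1, 0 ≤ slopeForce m M u)
    (hy : ∀ t, 0 ≤ t → y t ≤ 1) (hz : ∀ t, 0 ≤ t → 0 ≤ z t) :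
    IsConvexProfile k m M a b x y z := by
  have hzZ : ∀ t, 0 ≤ t → z t ≤ Z := by
    intro t ht
    have := le_of_hasDerivWithinAt_nonneg
      (fun u hu => ((h.hasDeriv_snd u hu).const_mul (k * |a|)).sub (h.hasDeriv_trd u hu))
      le_rfl ht fun u hu => by
        have hu0 : 0 ≤ u := hu.1.le
        rw [h.clip_fst hb0 hb1 hu0]
        have hx := (h.fst_mem hb0 hb1 hu0).1
        have hcz := (clip_mem hZ0 (z u)).1
        have hF' := hF _ (clip_mem hb1.le (y u))
        have h2 : 0 ≤ k * clip 0 Z (z u) * (|a| + x u) :=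
          mul_nonneg (mul_nonneg hk hcz) (by linarith [neg_abs_le a])
        nlinarith
    simp only [Pi.sub_apply, h.trd_zero, h.snd_zero] at this
    have h3 : 0 ≤ k * |a| := by positivity
    have h4 := mul_le_mul_of_nonneg_left (hy t ht) h3
    have h5 := mul_nonneg h3 hb0
    linarith
  have cy : ∀ t, 0 ≤ t → clip b 1 (y t) = y t := fun t ht =>
    clip_of_mem ⟨h.le_snd hZ0 ht, hy t ht⟩
  have cz : ∀ t, 0 ≤ t → clip 0 Z (z t) = z t := fun t ht => clip_of_mem ⟨hz t ht, hzZ t ht⟩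
  refine ⟨fun t ht => ?_, fun t ht => ?_, fun t ht => ?_, h.fst_zero, h.snd_zero, hy, hz⟩
  · simpa only [cy t ht] using h.hasDeriv_fst t ht
  · simpa only [cz t ht] using h.hasDeriv_snd t ht
  · simpa only [cy t ht, cz t ht, h.clip_fst hb0 hb1 ht] using h.hasDeriv_trd t ht

end IsClippedSolution

/-- Existence of a convex profile, by shooting on the initial curvature. -/
theorem exists_isConvexProfile {k m M a b : ℝ} (hk : 0 ≤ k) (hb0 : 0 ≤ b) (hb1 : b < 1)
    (hF : ∀ u ∈ Ico b 1, 0 < slopeForce m M u) :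
    ∃ x y z : ℝ → ℝ, IsConvexProfile k m M a b x y z := by
  have hF' : ∀ u ∈ Icc b 1, 0 ≤ slopeForce m M u := by
    intro u hu
    rcases hu.2.lt_or_eq with h | rfl
    · exact (hF u ⟨hu.1, h⟩).le
    · simp [slopeForce]
  set C := k * (|a| + 1) + (2 * |m| + |M|) + 2 with hC
  have hC2 : 2 ≤ C := by
    have : 0 ≤ k * (|a| + 1) + (2 * |m| + |M|) := by positivity
    linarith
  set Z := C + k * |a| with hZdef
  have hZ2 : 2 ≤ Z := by
    have : 0 ≤ k * |a| := by positivity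
    linarith
  have hZ0 : 0 ≤ Z := by linarith
  choose x y z h using fun c : ℝ => exists_isClippedSolution k m M a c hb0 hb1 hZ0
  have hopen : ∀ p : ℝ → ℝ → ℝ, (∀ T, ∃ K, 0 < K ∧ ∀ c c', ∀ t ∈ Icc 0 T,
      |p c t - p c' t| ≤ |c - c'| * K) → IsOpen {c | ∃ t, 0 ≤ t ∧ 0 < p c t} := by
    intro p hp
    rw [Metric.isOpen_iff]
    rintro c ⟨t, ht, hct⟩
    obtain ⟨K, hK, hpK⟩ := hp t
    refine ⟨p c t / K, div_pos hct hK, fun c' hc' => ⟨t, ht, ?_⟩⟩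
    rw [Metric.mem_ball, Real.dist_eq, lt_div_iff₀ hK] at hc'
    have := hpK c' c t ⟨ht, le_rfl⟩
    linarith [(abs_le.1 this).1]
  have hA : IsOpen {c | ∃ t, 0 ≤ t ∧ 0 < y c t - 1} := by
    refine hopen (fun c t => y c t - 1) fun T => ?_
    obtain ⟨K, hK, hd⟩ := IsClippedSolution.abs_sub_le (k := k) (m := m) (M := M) (a := a)
      hb0 hb1 hZ0 T
    refine ⟨K, hK, fun c c' t ht => ?_⟩
    rw [sub_sub_sub_cancel_right]
    exact (hd c c' _ _ _ _ _ _ (h c) (h c') t ht).2.1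
  have hB : IsOpen {c | ∃ t, 0 ≤ t ∧ 0 < -z c t} := by
    refine hopen (fun c t => -z c t) fun T => ?_
    obtain ⟨K, hK, hd⟩ := IsClippedSolution.abs_sub_le (k := k) (m := m) (M := M) (a := a)
      hb0 hb1 hZ0 T
    refine ⟨K, hK, fun c c' t ht => ?_⟩
    rw [neg_sub_neg, abs_sub_comm]
    exact (hd c c' _ _ _ _ _ _ (h c) (h c') t ht).2.2
  have hex : ∃ c ∈ Icc 0 C, (∀ t, 0 ≤ t → y c t ≤ 1) ∧ ∀ t, 0 ≤ t → 0 ≤ z c t := by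
    by_contra! hcov
    obtain ⟨c, hc, ⟨t, ht, hyt⟩, s, hs, hzs⟩ :=
      (isPreconnected_Icc : IsPreconnected (Icc 0 C)) _ _ hA hB
        (fun c hc => by
          by_cases hy : ∀ t, 0 ≤ t → y c t ≤ 1
          · obtain ⟨t, ht, hzt⟩ := hcov c hc hy
            exact Or.inr ⟨t, ht, by linarith⟩
          · push Not at hy
            obtain ⟨t, ht, hyt⟩ := hy
            exact Or.inl ⟨t, ht, by linarith⟩)
        ⟨C, ⟨by linarith, le_rfl⟩, 1, zero_le_one,
          by linarith [(h C).one_lt_snd hk hb0 hb1 hZ2 le_rfl]⟩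
        (by
          obtain ⟨t, ht, hzt⟩ := (h 0).exists_trd_neg hb1 hZ0 (hF b ⟨le_rfl, hb1⟩)
          exact ⟨0, ⟨le_rfl, by linarith⟩, t, ht, by linarith⟩)
    have := (h c).snd_le_one_of_trd_neg hb1 hZ0 hc.1 hF' hs ht (by linarith)
    linarith
  obtain ⟨c, hc, hy, hz⟩ := hex
  exact ⟨x c, y c, z c,
    (h c).isConvexProfile hk hb0 hb1 (by linarith [hc.2]) hZ0 hF' hy hz⟩

/-! ### Strict bounds and asymptotics of convex profiles -/

namespace IsConvexProfile

variable {k m M a b : ℝ} {x y z : ℝ → ℝ}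

lemma snd_mono (h : IsConvexProfile k m M a b x y z) {s t : ℝ} (hs : 0 ≤ s) (hst : s ≤ t) :
    y s ≤ y t :=
  le_of_hasDerivWithinAt_nonneg h.hasDeriv_snd hs hst fun _ hu => h.trd_nonneg _ (hs.trans hu.1.le)

lemma snd_mem (h : IsConvexProfile k m M a b x y z) {t : ℝ} (ht : 0 ≤ t) : y t ∈ Icc b 1 :=
  ⟨h.snd_zero ▸ h.snd_mono le_rfl ht, h.snd_le_one t ht⟩

lemma fst_mem (h : IsConvexProfile k m M a b x y z) (hb0 : 0 ≤ b) {t : ℝ}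
    (ht : 0 ≤ t) : x t ∈ Icc a (a + t) := by
  have h1 := le_of_hasDerivWithinAt_nonneg h.hasDeriv_fst le_rfl ht
    fun u hu => hb0.trans (h.snd_mem hu.1.le).1
  have h2 := le_of_hasDerivWithinAt_nonneg
    (fun s hs => (hasDerivWithinAt_id s (Ici (0 : ℝ))).sub (h.hasDeriv_fst s hs)) le_rfl ht
    fun u hu => sub_nonneg.2 (h.snd_mem hu.1.le).2
  simp only [Pi.sub_apply, id, h.fst_zero] at h1 h2
  exact ⟨h1, by linarith⟩

lemma trd_le_of_le_slopeForce (h : IsConvexProfile k m M a b x y z) (hk : 0 ≤ k) (hb0 : 0 ≤ b)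
    {γ : ℝ} (hF : ∀ s, 0 ≤ s → γ ≤ slopeForce m M (y s)) {t : ℝ} (ht : 0 ≤ t) :
    z t ≤ z 0 + k * |a| - γ * t := by
  have := le_of_hasDerivWithinAt_nonneg
    (fun u hu => (((h.hasDeriv_snd u hu).const_mul (k * |a|)).sub (h.hasDeriv_trd u hu)).sub
      ((hasDerivWithinAt_id u (Ici (0 : ℝ))).const_mul γ))
    le_rfl ht fun u hu => by
      have hu0 : 0 ≤ u := hu.1.le
      have hx := (h.fst_mem hb0 hu0).1
      have h2 : 0 ≤ k * z u * (|a| + x u) :=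
        mul_nonneg (mul_nonneg hk (h.trd_nonneg u hu0)) (by linarith [neg_abs_le a])
      nlinarith [hF u hu0]
  simp only [Pi.sub_apply, id, h.snd_zero] at this
  have h3 : 0 ≤ k * |a| := by positivity
  have h4 := mul_le_mul_of_nonneg_left (h.snd_le_one t ht) h3
  have h5 := mul_nonneg h3 hb0
  linarith

lemma slopeForce_nonneg (h : IsConvexProfile k m M a b x y z)
    (hF : ∀ u ∈ Ico b 1, 0 < slopeForce m M u) (t : ℝ) (ht : 0 ≤ t) :
    0 ≤ slopeForce m M (y t) := by
  rcases (h.snd_le_one t ht).lt_or_eq with h1 | h1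
  · exact (hF _ ⟨(h.snd_mem ht).1, h1⟩).le
  · simp [slopeForce, h1]

/-- Every profile also solves a clipped system, so the global Lipschitz estimate yields uniqueness
for given initial curvature. -/
lemma isClippedSolution (h : IsConvexProfile k m M a b x y z) (hk : 0 ≤ k) (hb0 : 0 ≤ b)
    (hF : ∀ u ∈ Ico b 1, 0 < slopeForce m M u) :
    IsClippedSolution k m M a b (z 0 + k * |a|) (z 0) x y z := by
  have cx : ∀ t, 0 ≤ t → clip (-(|a| + t)) (|a| + t) (x t) = x t := fun t ht => by
    have := h.fst_mem hb0 ht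
    exact clip_of_mem ⟨by linarith [this.1, neg_abs_le a], by linarith [this.2, le_abs_self a]⟩
  have cy : ∀ t, 0 ≤ t → clip b 1 (y t) = y t := fun t ht => clip_of_mem (h.snd_mem ht)
  have cz : ∀ t, 0 ≤ t → clip 0 (z 0 + k * |a|) (z t) = z t := fun t ht => clip_of_mem
    ⟨h.trd_nonneg t ht, by
      simpa using h.trd_le_of_le_slopeForce hk hb0 (h.slopeForce_nonneg hF) ht⟩
  refine ⟨fun t ht => ?_, fun t ht => ?_, fun t ht => ?_, h.fst_zero, h.snd_zero, rfl⟩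
  · simpa only [cy t ht] using h.hasDeriv_fst t ht
  · simpa only [cz t ht] using h.hasDeriv_snd t ht
  · simpa only [cx t ht, cy t ht, cz t ht] using h.hasDeriv_trd t ht

/-- A convex profile is determined by its initial curvature. -/
lemma eqOn_of_trd_zero_eq {x' y' z' : ℝ → ℝ} (h : IsConvexProfile k m M a b x y z)
    (h' : IsConvexProfile k m M a b x' y' z') (hk : 0 ≤ k) (hb0 : 0 ≤ b) (hb1 : b < 1)
    (hF : ∀ u ∈ Ico b 1, 0 < slopeForce m M u) (hz : z 0 = z' 0) : EqOn x x' (Ici 0) := by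
  intro t ht
  have hZ : 0 ≤ z 0 + k * |a| := add_nonneg (h.trd_nonneg 0 le_rfl) (by positivity)
  obtain ⟨K, -, hK⟩ := IsClippedSolution.abs_sub_le (k := k) (m := m) (M := M) (a := a) hb0 hb1
    hZ t
  have hc' := h'.isClippedSolution hk hb0 hF
  rw [← hz] at hc'
  have := (hK _ _ _ _ _ _ _ _ (h.isClippedSolution hk hb0 hF) hc' t ⟨ht, le_rfl⟩).1
  rw [sub_self, abs_zero, zero_mul] at this
  exact sub_eq_zero.1 (abs_nonpos_iff.1 this)

/-- Slope 1 with curvature 0 is an invariant state, which cannot be reached in finite time from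
slope b < 1. -/
lemma snd_lt_one (h : IsConvexProfile k m M a b x y z) (hk : 0 ≤ k) (hb0 : 0 ≤ b) (hb1 : b < 1)
    {t : ℝ} (ht : 0 ≤ t) : y t < 1 := by
  refine (h.snd_le_one t ht).lt_of_ne fun hy => ?_
  have hz : z t = 0 := by
    by_contra hne
    have hpos : 0 < z t := (h.trd_nonneg t ht).lt_of_ne' hne
    obtain ⟨s, hts, hs⟩ := exists_neg_of_hasDerivWithinAt_neg ht
      ((hasDerivWithinAt_const t (Ici 0) (1 : ℝ)).sub (h.hasDeriv_snd t ht)) (by linarith)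
      (by simp [hy])
    simp only [Pi.sub_apply] at hs
    linarith [h.snd_le_one s (ht.trans hts.le)]
  set G := 2 * |m| + |M| with hG
  have hG0 : 0 ≤ G := by positivity
  set K := k * (|a| + t) + 1 + G with hK
  -- With this K, (z + 1 - y) exp(K u) is nondecreasing on [0, t]; it is positive at 0 and would
  -- vanish at t.
  have := le_of_hasDerivWithinAt_nonneg
    (fun u hu => ((((h.hasDeriv_trd u hu).add_const 1).sub (h.hasDeriv_snd u hu))).mul
      (((hasDerivWithinAt_id u (Ici (0 : ℝ))).const_mul K).exp)) le_rfl ht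
    fun u hu => by
      have hu0 : 0 ≤ u := hu.1.le
      have hx := (h.fst_mem hb0 hu0).2
      have hz0 := h.trd_nonneg u hu0
      have hy := h.snd_mem hu0
      have hF := (le_abs_self _).trans (abs_slopeForce_le (m := m) (M := M)
          (⟨hb0.trans hy.1, hy.2⟩ : y u ∈ Icc (0 : ℝ) 1))
      have h1 : 0 ≤ k * z u * (|a| + t - x u) :=
        mul_nonneg (mul_nonneg hk hz0) (by linarith [le_abs_self a, hu.2])
      have h2 : 0 ≤ (k * (|a| + t) + 1) * (1 - y u) :=
        mul_nonneg (by positivity) (by linarith [hy.2])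
      have h3 : 0 ≤ G * z u := mul_nonneg hG0 hz0
      have e : 0 ≤ -(k * x u * z u) - slopeForce m M (y u) - z u + (z u + 1 - y u) * K := by
        rw [hK]; nlinarith
      have := mul_nonneg e (Real.exp_pos (K * u)).le
      simp only [Pi.sub_apply, id, mul_one]
      nlinarith
  simp only [Pi.mul_apply, Pi.sub_apply, id, mul_zero, Real.exp_zero, mul_one, hz, hy,
    h.snd_zero] at this
  linarith [h.trd_nonneg 0 le_rfl]

/-- At a zero of z, z' = -F(y) < 0 because y < 1, so z would turn negative. -/
lemma trd_pos (h : IsConvexProfile k m M a b x y z) (hk : 0 ≤ k) (hb0 : 0 ≤ b) (hb1 : b < 1)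
    (hF : ∀ u ∈ Ico b 1, 0 < slopeForce m M u) {t : ℝ} (ht : 0 ≤ t) : 0 < z t := by
  refine (h.trd_nonneg t ht).lt_of_ne' fun hz => ?_
  obtain ⟨s, hts, hs⟩ := exists_neg_of_hasDerivWithinAt_neg ht (h.hasDeriv_trd t ht)
    (by
      have := hF _ ⟨(h.snd_mem ht).1, h.snd_lt_one hk hb0 hb1 ht⟩
      rw [hz]; linarith) hz
  linarith [h.trd_nonneg s (ht.trans hts.le)]

lemma exists_lt_snd (h : IsConvexProfile k m M a b x y z) (hk : 0 ≤ k) (hb0 : 0 ≤ b)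
    (hF : ∀ u ∈ Ico b 1, 0 < slopeForce m M u) {μ : ℝ} (hμ : μ < 1) : ∃ t, 0 ≤ t ∧ μ < y t := by
  by_contra! hle
  have hbμ : b ≤ μ := h.snd_zero ▸ hle 0 le_rfl
  obtain ⟨w, hw, hmin⟩ := (isCompact_Icc (a := b) (b := μ)).exists_isMinOn
    (nonempty_Icc.2 hbμ) (f := slopeForce m M) (by unfold slopeForce; fun_prop)
  have hγ : 0 < slopeForce m M w := hF w ⟨hw.1, hw.2.trans_lt hμ⟩
  set γ := slopeForce m M w
  -- At this time the linear upper bound for z equals -1.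
  set t := (z 0 + k * |a| + 1) / γ with ht
  have hz0 := h.trd_nonneg 0 le_rfl
  have ht0 : 0 ≤ t := by positivity
  have := h.trd_le_of_le_slopeForce hk hb0 (γ := γ)
    (fun s hs => hmin ⟨(h.snd_mem hs).1, hle s hs⟩) ht0
  rw [ht, mul_div_cancel₀ _ hγ.ne'] at this
  linarith [h.trd_nonneg t ht0]

lemma tendsto_snd (h : IsConvexProfile k m M a b x y z) (hk : 0 ≤ k) (hb0 : 0 ≤ b)
    (hF : ∀ u ∈ Ico b 1, 0 < slopeForce m M u) : Tendsto y atTop (𝓝 1) := by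
  refine tendsto_order.2 ⟨fun μ hμ => ?_, fun μ hμ => ?_⟩
  · obtain ⟨t, ht, hy⟩ := h.exists_lt_snd hk hb0 hF hμ
    filter_upwards [eventually_ge_atTop t] with s hs
    exact hy.trans_le (h.snd_mono ht hs)
  · filter_upwards [eventually_ge_atTop 0] with s hs
    exact (h.snd_le_one s hs).trans_lt hμ

lemma exists_forall_one_le_mul_fst (h : IsConvexProfile k m M a b x y z) (hk : 0 < k)
    (hb0 : 0 ≤ b) (hF : ∀ u ∈ Ico b 1, 0 < slopeForce m M u) :
    ∃ T, 0 ≤ T ∧ ∀ t, T ≤ t → 1 ≤ k * x t := by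
  obtain ⟨s, hs, hy⟩ := h.exists_lt_snd hk.le hb0 hF (show (1 / 2 : ℝ) < 1 by norm_num)
  refine ⟨s + 2 * (|a| + 1 / k), by positivity, fun t ht => ?_⟩
  have hst : s ≤ t := le_trans (le_add_of_nonneg_right (by positivity)) ht
  have := le_of_hasDerivWithinAt_nonneg
    (fun u hu => (h.hasDeriv_fst u hu).sub
      ((hasDerivWithinAt_id u (Ici (0 : ℝ))).const_mul (1 / 2))) hs hst
    fun u hu => by linarith [h.snd_mono hs hu.1.le]
  simp only [Pi.sub_apply, id] at this
  have hx := (h.fst_mem hb0 hs).1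
  have hxt : 1 / k ≤ x t := by linarith [neg_abs_le a]
  rwa [div_le_iff₀' hk] at hxt

lemma exists_le_fst_sub (h : IsConvexProfile k m M a b x y z) (hk : 0 < k)
    (hb0 : 0 ≤ b) (hF : ∀ u ∈ Ico b 1, 0 < slopeForce m M u) :
    ∃ L, ∀ t, 0 ≤ t → L ≤ x t - t := by
  obtain ⟨T, hT, hkx⟩ := h.exists_forall_one_le_mul_fst hk hb0 hF
  -- Past T, (z + y)' = (1 - k x) z - F(y) ≤ 0, while z ≥ 0 and y tends to 1.
  have hv : ∀ t, T ≤ t → 1 ≤ z t + y t := by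
    intro t ht
    have ht0 := hT.trans ht
    by_contra! hlt
    obtain ⟨s, hs, hys⟩ := h.exists_lt_snd hk.le hb0 hF hlt
    have hy := hys.trans_le (h.snd_mono hs (le_max_left s t))
    have := le_of_hasDerivWithinAt_nonneg
      (fun u hu => ((h.hasDeriv_trd u hu).add (h.hasDeriv_snd u hu)).neg) ht0
      (le_max_right s t) fun u hu => by
        have hu0 : 0 ≤ u := ht0.trans hu.1.le
        have := mul_le_mul_of_nonneg_right (hkx u (ht.trans hu.1.le)) (h.trd_nonneg u hu0)
        linarith [h.slopeForce_nonneg hF u hu0]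
    simp only [Pi.neg_apply, Pi.add_apply] at this
    linarith [h.trd_nonneg (max s t) (hs.trans (le_max_left _ _))]
  refine ⟨x T - T - 1, fun t ht => ?_⟩
  rcases le_total T t with hTt | htT
  -- As 1 - y ≤ z = y', the quantity x - t + y is nondecreasing past T.
  · have := le_of_hasDerivWithinAt_nonneg
      (fun u hu => ((h.hasDeriv_fst u hu).sub (hasDerivWithinAt_id u (Ici (0 : ℝ)))).add
        (h.hasDeriv_snd u hu)) hT hTt fun u hu => by linarith [hv u hu.1.le]
    simp only [Pi.sub_apply, Pi.add_apply, id] at this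
    linarith [h.snd_le_one t ht, hb0.trans (h.snd_mem hT).1]
  · have := le_of_hasDerivWithinAt_nonneg
      (fun u hu => (hasDerivWithinAt_id u (Ici (0 : ℝ))).sub (h.hasDeriv_fst u hu)) ht htT
      fun u hu => by linarith [h.snd_le_one u (ht.trans hu.1.le)]
    simp only [Pi.sub_apply, id] at this
    linarith

/-- A convex profile is asymptotic to a line of slope `1`, and lies above it. -/
lemma exists_asymptote (h : IsConvexProfile k m M a b x y z) (hk : 0 < k)
    (hb0 : 0 ≤ b) (hb1 : b < 1) (hF : ∀ u ∈ Ico b 1, 0 < slopeForce m M u) :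
    ∃ l, l < a ∧ Tendsto (fun t => x t - (t + l)) atTop (𝓝 0) ∧
      ∀ t, 0 ≤ t → t + l ≤ x t ∧ x t ≤ t + a := by
  obtain ⟨L, hL⟩ := h.exists_le_fst_sub hk hb0 hF
  -- Freezing time at 0 for negative arguments makes the function antitone on all of ℝ.
  set D : ℝ → ℝ := fun t => x (max t 0) - max t 0 with hD
  have hanti : Antitone D := by
    intro s t hst
    have := le_of_hasDerivWithinAt_nonneg
      (fun u hu => (hasDerivWithinAt_id u (Ici (0 : ℝ))).sub (h.hasDeriv_fst u hu))
      (le_max_right s 0) (max_le_max_right 0 hst)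
      fun u hu => by linarith [h.snd_le_one u ((le_max_right s 0).trans hu.1.le)]
    simp only [Pi.sub_apply, id] at this
    simp only [hD]
    linarith
  have hbdd : BddBelow (range D) := ⟨L, by
    rintro _ ⟨t, rfl⟩
    exact hL _ (le_max_right t 0)⟩
  have hlim := tendsto_atTop_ciInf hanti hbdd
  have hle : ∀ t, 0 ≤ t → iInf D ≤ x t - t := fun t ht => by
    have := ciInf_le hbdd t
    simpa only [hD, max_eq_left ht] using this
  refine ⟨iInf D, ?_, ?_, fun t ht => ⟨by linarith [hle t ht], ?_⟩⟩
  · have := le_of_hasDerivWithinAt_nonneg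
      (fun u hu => ((hasDerivWithinAt_id u (Ici (0 : ℝ))).const_mul (y 1)).sub
        (h.hasDeriv_fst u hu)) le_rfl zero_le_one
      fun u hu => by linarith [h.snd_mono hu.1.le hu.2.le]
    simp only [Pi.sub_apply, id, h.fst_zero] at this
    linarith [hle 1 zero_le_one, h.snd_lt_one hk.le hb0 hb1 (zero_le_one (α := ℝ))]
  · have := hlim.sub_const (iInf D)
    rw [sub_self] at this
    refine this.congr' ?_
    filter_upwards [eventually_ge_atTop 0] with t ht
    simp only [hD, max_eq_left ht]
    ring
  · linarith [(h.fst_mem hb0 ht).2]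

end IsConvexProfile

/-! ### Uniqueness, with the slope as independent variable -/

/-- The curvature `p` and the height `q` of a convex profile as functions of its slope. -/
structure IsCroccoCurve (k m M a b c : ℝ) (p q : ℝ → ℝ) : Prop where
  continuousOn_fst : ContinuousOn p (Ico b 1)
  continuousOn_snd : ContinuousOn q (Ico b 1)
  fst_pos : ∀ u ∈ Ico b 1, 0 < p u
  hasDeriv_fst : ∀ u ∈ Ioo b 1, HasDerivAt p (-(k * q u) - slopeForce m M u / p u) u
  hasDeriv_snd : ∀ u ∈ Ioo b 1, HasDerivAt q (u / p u) u
  fst_left : p b = c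
  snd_left : q b = a
  exists_fst_lt : ∀ w, 0 < w → ∃ u ∈ Ico b 1, p u < w

/-- Positive curvature makes y a strictly increasing bijection from [0, ∞) onto [b, 1); τ is its
inverse. -/
lemma IsConvexProfile.exists_isCroccoCurve {k m M a b : ℝ} {x y z : ℝ → ℝ}
    (h : IsConvexProfile k m M a b x y z) (hk : 0 ≤ k) (hb0 : 0 ≤ b) (hb1 : b < 1)
    (hF : ∀ u ∈ Ico b 1, 0 < slopeForce m M u) :
    ∃ p q : ℝ → ℝ, IsCroccoCurve k m M a b (z 0) p q := by
  have hzpos : ∀ t, 0 ≤ t → 0 < z t := fun t ht => h.trd_pos hk hb0 hb1 hF ht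
  have hyc : ContinuousOn y (Ici 0) := fun t ht => (h.hasDeriv_snd t ht).continuousWithinAt
  have hmono : StrictMonoOn y (Ici 0) := by
    refine strictMonoOn_of_hasDerivWithinAt_pos (convex_Ici 0) hyc (f' := z)
      (fun t ht => ?_) (fun t ht => ?_)
    · exact (h.hasDeriv_snd t (interior_subset ht)).mono interior_subset
    · exact hzpos t (interior_subset ht)
  have hsurj : ∀ u, ∃ t, u ∈ Ico b 1 → 0 ≤ t ∧ y t = u := by
    intro u
    by_cases hu : u ∈ Ico b 1
    · obtain ⟨T, hT, huT⟩ := h.exists_lt_snd hk hb0 hF hu.2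
      obtain ⟨t, ht, hty⟩ := intermediate_value_Icc hT (hyc.mono fun t ht => ht.1)
        (show u ∈ Icc (y 0) (y T) from ⟨h.snd_zero ▸ hu.1, huT.le⟩)
      exact ⟨t, fun _ => ⟨ht.1, hty⟩⟩
    · exact ⟨0, fun h => absurd h hu⟩
  choose τ hτ using hsurj
  have hτc : ContinuousOn τ (Ico b 1) := by
    intro u hu
    refine tendsto_order.2 ⟨fun r hr => ?_, fun r hr => ?_⟩
    · rcases lt_or_ge r 0 with hr0 | hr0
      · filter_upwards [self_mem_nhdsWithin] with w hw
        exact hr0.trans_le (hτ w hw).1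
      · have hyr : y r < u := (hτ u hu).2 ▸ hmono hr0 (hτ u hu).1 hr
        filter_upwards [self_mem_nhdsWithin, mem_nhdsWithin_of_mem_nhds (lt_mem_nhds hyr)]
          with w hw hw'
        rw [← (hτ w hw).2] at hw'
        exact (hmono.lt_iff_lt hr0 (hτ w hw).1).1 hw'
    · have hr0 : 0 ≤ r := (hτ u hu).1.trans hr.le
      have hyr : u < y r := (hτ u hu).2 ▸ hmono (hτ u hu).1 hr0 hr
      filter_upwards [self_mem_nhdsWithin, mem_nhdsWithin_of_mem_nhds (gt_mem_nhds hyr)]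
        with w hw hw'
      rw [← (hτ w hw).2] at hw'
      exact (hmono.lt_iff_lt (hτ w hw).1 hr0).1 hw'
  have hτmem : MapsTo τ (Ico b 1) (Ici 0) := fun u hu => (hτ u hu).1
  have hτb : τ b = 0 := by
    have := hτ b ⟨le_rfl, hb1⟩
    exact hmono.injOn this.1 (mem_Ici.2 le_rfl) (this.2.trans h.snd_zero.symm)
  have hτpos : ∀ u ∈ Ioo b 1, 0 < τ u := fun u hu => by
    have := hτ u ⟨hu.1.le, hu.2⟩
    refine this.1.lt_of_ne fun h0 => ?_
    rw [← h0, h.snd_zero] at this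
    exact hu.1.ne this.2
  have hat : ∀ {φ : ℝ → ℝ} {d t : ℝ}, 0 < t → HasDerivWithinAt φ d (Ici 0) t →
      HasDerivAt φ d t := fun ht hd => hd.hasDerivAt (Ici_mem_nhds ht)
  have hτd : ∀ u ∈ Ioo b 1, HasDerivAt τ (z (τ u))⁻¹ u := fun u hu => by
    have ht := hτpos u hu
    refine HasDerivAt.of_local_left_inverse (f := y)
      (hτc.continuousAt (Ico_mem_nhds hu.1 hu.2)) (hat ht (h.hasDeriv_snd _ ht.le))
      (hzpos _ ht.le).ne' ?_
    filter_upwards [Ico_mem_nhds hu.1 hu.2] with w hw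
    exact (hτ w hw).2
  refine ⟨z ∘ τ, x ∘ τ, ?_, ?_, ?_, ?_, ?_, ?_, ?_, ?_⟩
  · exact ContinuousOn.comp (fun t ht => (h.hasDeriv_trd t ht).continuousWithinAt) hτc hτmem
  · exact ContinuousOn.comp (fun t ht => (h.hasDeriv_fst t ht).continuousWithinAt) hτc hτmem
  · exact fun u hu => hzpos _ (hτ u hu).1
  · intro u hu
    have ht := hτpos u hu
    refine ((hat ht (h.hasDeriv_trd _ ht.le)).comp u (hτd u hu)).congr_deriv ?_
    have := (hzpos _ ht.le).ne'
    rw [(hτ u ⟨hu.1.le, hu.2⟩).2]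
    simp only [Function.comp]
    field_simp
  · intro u hu
    have ht := hτpos u hu
    refine ((hat ht (h.hasDeriv_fst _ ht.le)).comp u (hτd u hu)).congr_deriv ?_
    rw [(hτ u ⟨hu.1.le, hu.2⟩).2]
    simp only [Function.comp, div_eq_mul_inv]
  · simp [hτb]
  · simp [hτb, h.fst_zero]
  · intro w hw
    by_contra! hge
    -- Curvature at least w would raise the slope by 1 within time 1 / w.
    have ht0 : 0 ≤ 1 / w := by positivity
    have hge' : ∀ t, 0 ≤ t → w ≤ z t := fun t ht => by
      have hu : y t ∈ Ico b 1 := ⟨(h.snd_mem ht).1, h.snd_lt_one hk hb0 hb1 ht⟩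
      have hτt : τ (y t) = t := hmono.injOn (hτ _ hu).1 ht (hτ _ hu).2
      simpa only [Function.comp, hτt] using hge _ hu
    have := le_of_hasDerivWithinAt_nonneg
      (fun u hu => (h.hasDeriv_snd u hu).sub
        ((hasDerivWithinAt_id u (Ici (0 : ℝ))).const_mul w)) le_rfl ht0
      fun u hu => by linarith [hge' u hu.1.le]
    simp only [Pi.sub_apply, id, h.snd_zero, mul_one_div_cancel hw.ne'] at this
    linarith [h.snd_lt_one hk hb0 hb1 ht0]

/-- Smaller curvature means faster growth of height per unit of slope, so q₁ ≥ q₂; together with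
F/p₁ ≥ F/p₂ this gives p₂' ≥ p₁'. -/
lemma IsCroccoCurve.sub_le_sub {k m M a b c₁ c₂ : ℝ} {p₁ q₁ p₂ q₂ : ℝ → ℝ}
    (h₁ : IsCroccoCurve k m M a b c₁ p₁ q₁) (h₂ : IsCroccoCurve k m M a b c₂ p₂ q₂)
    (hk : 0 ≤ k) (hb0 : 0 ≤ b) (hF : ∀ u ∈ Ico b 1, 0 < slopeForce m M u) {s : ℝ}
    (hs : s ∈ Ico b 1) (hlt : ∀ u ∈ Ico b s, p₁ u < p₂ u) : c₂ - c₁ ≤ p₂ s - p₁ s := by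
  have hsub : Icc b s ⊆ Ico b 1 := fun u hu => ⟨hu.1, hu.2.trans_lt hs.2⟩
  have hsub' : Ioo b s ⊆ Ioo b 1 := fun u hu => ⟨hu.1, hu.2.trans hs.2⟩
  have hinv : ∀ u ∈ Ioo b s, 1 / p₂ u ≤ 1 / p₁ u := fun u hu =>
    one_div_le_one_div_of_le (h₁.fst_pos u (hsub ⟨hu.1.le, hu.2.le⟩)) (hlt u ⟨hu.1.le, hu.2⟩).le
  have hq : MonotoneOn (q₁ - q₂) (Icc b s) := by
    refine monotoneOn_of_hasDerivWithinAt_nonneg (convex_Icc b s)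
      (f' := fun u => u / p₁ u - u / p₂ u)
      ((h₁.continuousOn_snd.sub h₂.continuousOn_snd).mono hsub) ?_ ?_ <;> rw [interior_Icc]
    · exact fun u hu => ((h₁.hasDeriv_snd u (hsub' hu)).sub
        (h₂.hasDeriv_snd u (hsub' hu))).hasDerivWithinAt
    · intro u hu
      have := mul_le_mul_of_nonneg_left (hinv u hu) (hb0.trans hu.1.le)
      simp only [mul_one_div] at this
      linarith
  have hp : MonotoneOn (p₂ - p₁) (Icc b s) := by
    refine monotoneOn_of_hasDerivWithinAt_nonneg (convex_Icc b s)
      (f' := fun u => (-(k * q₂ u) - slopeForce m M u / p₂ u)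
        - (-(k * q₁ u) - slopeForce m M u / p₁ u))
      ((h₂.continuousOn_fst.sub h₁.continuousOn_fst).mono hsub) ?_ ?_ <;> rw [interior_Icc]
    · exact fun u hu => ((h₂.hasDeriv_fst u (hsub' hu)).sub
        (h₁.hasDeriv_fst u (hsub' hu))).hasDerivWithinAt
    · intro u hu
      have h1 := mul_le_mul_of_nonneg_left (hinv u hu) (hF u (hsub ⟨hu.1.le, hu.2.le⟩)).le
      have h2 := hq (left_mem_Icc.2 hs.1) ⟨hu.1.le, hu.2.le⟩ hu.1.le
      simp only [Pi.sub_apply, h₁.snd_left, h₂.snd_left, sub_self] at h2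
      have h3 := mul_nonneg hk h2
      simp only [mul_one_div] at h1
      linarith
  have := hp (left_mem_Icc.2 hs.1) (right_mem_Icc.2 hs.1) hs.1
  simpa only [Pi.sub_apply, h₁.fst_left, h₂.fst_left] using this

lemma IsCroccoCurve.le_of_isCroccoCurve {k m M a b c₁ c₂ : ℝ} {p₁ q₁ p₂ q₂ : ℝ → ℝ}
    (h₁ : IsCroccoCurve k m M a b c₁ p₁ q₁) (h₂ : IsCroccoCurve k m M a b c₂ p₂ q₂)
    (hk : 0 ≤ k) (hb0 : 0 ≤ b) (hF : ∀ u ∈ Ico b 1, 0 < slopeForce m M u) : c₂ ≤ c₁ := by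
  by_contra! hc
  have hlt : ∀ u ∈ Ico b 1, p₁ u < p₂ u := by
    intro u hu
    by_contra! hle
    obtain ⟨r, hr, hr0, hpos⟩ := exists_first_zero (h := fun u => p₂ u - p₁ u) hu.1
      ((h₂.continuousOn_fst.sub h₁.continuousOn_fst).mono
        fun w hw => ⟨hw.1, hw.2.trans_lt hu.2⟩)
      (by simp only [h₁.fst_left, h₂.fst_left]; linarith) (by linarith)
    have := h₁.sub_le_sub h₂ hk hb0 hF (s := r) ⟨hr.1.le, hr.2.trans_lt hu.2⟩
      fun w hw => by linarith [hpos w hw]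
    linarith
  obtain ⟨u, hu, hpu⟩ := h₂.exists_fst_lt (c₂ - c₁) (by linarith)
  have := h₁.sub_le_sub h₂ hk hb0 hF hu fun w hw => hlt w ⟨hw.1, hw.2.trans hu.2⟩
  linarith [h₁.fst_pos u hu]

theorem IsConvexProfile.eqOn {k m M a b : ℝ} {x y z x' y' z' : ℝ → ℝ}
    (h : IsConvexProfile k m M a b x y z) (h' : IsConvexProfile k m M a b x' y' z')
    (hk : 0 ≤ k) (hb0 : 0 ≤ b) (hb1 : b < 1) (hF : ∀ u ∈ Ico b 1, 0 < slopeForce m M u) :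
    EqOn x x' (Ici 0) := by
  obtain ⟨p, q, hpq⟩ := h.exists_isCroccoCurve hk hb0 hb1 hF
  obtain ⟨p', q', hpq'⟩ := h'.exists_isCroccoCurve hk hb0 hb1 hF
  exact h.eqOn_of_trd_zero_eq h' hk hb0 hb1 hF
    (le_antisymm (hpq'.le_of_isCroccoCurve hpq hk hb0 hF)
      (hpq.le_of_isCroccoCurve hpq' hk hb0 hF))

/-! ### Back to the third order equation -/

lemma IsConvexMHDSolution.isConvexProfile {m M a b : ℝ} {f : ℝ → ℝ}
    (h : IsConvexMHDSolution m M a b f) :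
    IsConvexProfile ((m + 1) / 2) m M a b f (derivWithin f (Ici 0))
      (derivWithin (derivWithin f (Ici 0)) (Ici 0)) := by
  obtain ⟨hs, hconv⟩ := h
  have hU := uniqueDiffOn_Ici (0 : ℝ)
  have h1 : ContDiffOn ℝ 2 (derivWithin f (Ici 0)) (Ici 0) :=
    hs.contDiffOn.derivWithin hU (by norm_num)
  have h2 : ContDiffOn ℝ 1 (derivWithin (derivWithin f (Ici 0)) (Ici 0)) (Ici 0) :=
    h1.derivWithin hU (by norm_num)
  have hd0 : DifferentiableOn ℝ f (Ici 0) := hs.contDiffOn.differentiableOn (by norm_num)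
  have hmono := hconv.monotoneOn_derivWithin hd0
  refine ⟨fun t ht => (hd0 t ht).hasDerivWithinAt,
    fun t ht => (h1.differentiableOn (by norm_num) t ht).hasDerivWithinAt, fun t ht => ?_,
    hs.apply_zero, hs.deriv_zero, fun t ht => ?_, fun t ht => hmono.derivWithin_nonneg⟩
  · have hd := (h2.differentiableOn (by norm_num) t ht).hasDerivWithinAt
    have he := hs.equation t ht
    simp only [iteratedDerivWithin_succ, iteratedDerivWithin_zero] at he
    refine hd.congr_deriv ?_
    simp only [slopeForce]
    linarith
  -- By convexity f' is monotone, so it stays below its limit 1.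
  · refine ge_of_tendsto hs.deriv_infty ?_
    filter_upwards [eventually_ge_atTop t] with s hts
    exact hmono ht (mem_Ici.2 (le_trans ht hts)) hts

lemma IsConvexProfile.isConvexMHDSolution {m M a b : ℝ} {x y z : ℝ → ℝ}
    (h : IsConvexProfile ((m + 1) / 2) m M a b x y z) (hlim : Tendsto y atTop (𝓝 1)) :
    IsConvexMHDSolution m M a b x := by
  have hU := uniqueDiffOn_Ici (0 : ℝ)
  have e1 : EqOn (derivWithin x (Ici 0)) y (Ici 0) := fun t ht =>
    (h.hasDeriv_fst t ht).derivWithin (hU t ht)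
  have e2 : EqOn (derivWithin (derivWithin x (Ici 0)) (Ici 0)) z (Ici 0) := fun t ht => by
    rw [derivWithin_congr e1 (e1 ht)]
    exact (h.hasDeriv_snd t ht).derivWithin (hU t ht)
  have e3 : EqOn (derivWithin (derivWithin (derivWithin x (Ici 0)) (Ici 0)) (Ici 0))
      (fun t => -((m + 1) / 2 * x t * z t) - slopeForce m M (y t)) (Ici 0) := fun t ht => by
    rw [derivWithin_congr e2 (e2 ht)]
    exact (h.hasDeriv_trd t ht).derivWithin (hU t ht)
  have cx : ContinuousOn x (Ici 0) := fun t ht => (h.hasDeriv_fst t ht).continuousWithinAt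
  have cy : ContinuousOn y (Ici 0) := fun t ht => (h.hasDeriv_snd t ht).continuousWithinAt
  have cz : ContinuousOn z (Ici 0) := fun t ht => (h.hasDeriv_trd t ht).continuousWithinAt
  have C1 : ContDiffOn ℝ 1 z (Ici 0) := by
    rw [contDiffOn_one_iff_derivWithin hU]
    refine ⟨fun t ht => (h.hasDeriv_trd t ht).differentiableWithinAt, ?_⟩
    refine ContinuousOn.congr
      (f := fun t => -((m + 1) / 2 * x t * z t) - slopeForce m M (y t)) ?_
      fun t ht => (h.hasDeriv_trd t ht).derivWithin (hU t ht)
    unfold slopeForce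
    fun_prop
  have C2 : ContDiffOn ℝ (1 + 1) y (Ici 0) := (contDiffOn_succ_iff_derivWithin hU).2
    ⟨fun t ht => (h.hasDeriv_snd t ht).differentiableWithinAt, by simp,
      C1.congr fun t ht => (h.hasDeriv_snd t ht).derivWithin (hU t ht)⟩
  have C3 : ContDiffOn ℝ (1 + 1 + 1) x (Ici 0) := (contDiffOn_succ_iff_derivWithin hU).2
    ⟨fun t ht => (h.hasDeriv_fst t ht).differentiableWithinAt, by simp, C2.congr e1⟩
  refine ⟨⟨by simpa [one_add_one_eq_two, two_add_one_eq_three] using C3, fun t ht => ?_,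
    h.fst_zero, (e1 (mem_Ici.2 le_rfl)).trans h.snd_zero, ?_⟩, ?_⟩
  · simp only [iteratedDerivWithin_succ, iteratedDerivWithin_zero]
    rw [e1 ht, e2 ht, e3 ht]
    simp only [slopeForce]
    ring
  · refine hlim.congr' ?_
    filter_upwards [eventually_ge_atTop 0] with t ht
    exact (e1 ht).symm
  · exact convexOn_of_hasDerivWithinAt2_nonneg (convex_Ici 0) cx
      (fun t ht => (h.hasDeriv_fst t (interior_subset ht)).mono interior_subset)
      (fun t ht => (h.hasDeriv_snd t (interior_subset ht)).mono interior_subset)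
      fun t ht => h.trd_nonneg t (interior_subset ht)

/-- With 1 - u factored out, the affine factor m(1 + u) + M is compared with its value at u = 1 if m
< 0 and at u = b if m ≥ 0. -/
lemma slopeForce_pos {m M b : ℝ}
    (hmM : (-1 < m ∧ m < 0 ∧ -2 * m ≤ M) ∨ (0 ≤ m ∧ -m * (b + 1) < M)) {u : ℝ}
    (hu : u ∈ Ico b 1) : 0 < slopeForce m M u := by
  have e : slopeForce m M u = (1 - u) * (m * (1 + u) + M) := by simp only [slopeForce]; ring
  rw [e]
  refine mul_pos (sub_pos.2 hu.2) ?_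
  rcases hmM with ⟨-, hm, hM⟩ | ⟨hm, hM⟩
  · nlinarith [mul_pos_of_neg_of_neg hm (sub_neg.2 hu.2)]
  · nlinarith [mul_nonneg hm (sub_nonneg.2 hu.1)]

theorem mainTheorem2 (a b m M : ℝ) (hb0 : 0 ≤ b) (hb1 : b < 1)
    (hmM : (-1 < m ∧ m < 0 ∧ -2 * m ≤ M) ∨ (0 ≤ m ∧ -m * (b + 1) < M)) :
    ∃ f : ℝ → ℝ, IsConvexMHDSolution m M a b f ∧
      (∀ g : ℝ → ℝ, IsConvexMHDSolution m M a b g → Set.EqOn g f (Set.Ici 0)) ∧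
      ∃ l : ℝ, l < a ∧
        Filter.Tendsto (fun t => f t - (t + l)) Filter.atTop (nhds 0) ∧
        ∀ t : ℝ, 0 ≤ t → t + l ≤ f t ∧ f t ≤ t + a := by
  have hk : 0 < (m + 1) / 2 := by
    rcases hmM with ⟨hm, -, -⟩ | ⟨hm, -⟩ <;> linarith
  have hF : ∀ u ∈ Ico b 1, 0 < slopeForce m M u := fun u hu => slopeForce_pos hmM hu
  obtain ⟨x, y, z, h⟩ := exists_isConvexProfile (a := a) hk.le hb0 hb1 hF
  exact ⟨x, h.isConvexMHDSolution (h.tendsto_snd hk.le hb0 hF),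
    fun g hg => hg.isConvexProfile.eqOn h hk.le hb0 hb1 hF,
    h.exists_asymptote hk hb0 hb1 hF⟩
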